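/- Let $n\ge 1$ and let $D_n$ be the set of $n$-qubit density matrices, that is, of positive semidefinite operators of trace one on $(\mathbb C^2)^{\otimes n}$ (so $D_0=\{1\}$). For $\rho\in D_n$ and $j\in\{1,\dots,n\}$ let $\operatorname{tr}_j\rho\in D_{n-1}$ be the reduced density matrix obtained by taking the partial trace of $\rho$ over qubit $j$. Call $\rho\in D_n$ undetermined by its reduced density matrices if there is a state $\omega\in D_n$, pure or mixed, with $\omega\ne\rho$ and $\operatorname{tr}_j\omega=\operatorname{tr}_j\rho$ for every $j\in\{1,\dots,n\}$. Let $|\psi\rangle\in(\mathbb C^2)^{\otimes n}$ be an $n$-qubit pure state, $\langle\psi|\psi\rangle=1$. Then $|\psi\rangle\langle\psi|$ is undetermined by its reduced density matrices if and only if $|\psi\rangle$ is local-unitary equivalent to a generalized $n$-qubit GHZ state, that is, if and only if there are unitary $2\times 2$ matrices $U_1,\dots,U_n$ and complex numbers $\alpha,\beta$ with $\alpha\beta\ne 0$ such that $$|\psi\rangle=(U_1\otimes\cdots\otimes U_n)\bigl(\alpha|0\cdots 0\rangle+\beta|1\cdots 1\rangle\bigr),$$ where $\alpha|0\cdots 0\rangle+\beta|1\cdots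 1\rangle$ is a unit vector. -/

import Mathlib

open scoped ComplexOrder Matrix

noncomputable section

namespace Qubits

/-- Labels of the computational basis of `n` qubits: bit strings of length `n`. -/
abbrev Bits (n : ℕ) : Type := Fin n → Fin 2

/-- `n`-qubit pure states: unit vectors of `(ℂ²)^{⊗ n}`, in coordinates with respect to the
computational basis. -/
abbrev PureState (n : ℕ) : Type := {ψ : EuclideanSpace ℂ (Bits n) // ‖ψ‖ = 1}

/-- The set `D_n` of `n`-qubit density matrices (arbitrary states, pure or mixed): positive
semidefinite matrices of trace one. -/
abbrev DensityMatrix (n : ℕ) : Type :=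
  {ρ : Matrix (Bits n) (Bits n) ℂ // ρ.PosSemidef ∧ ρ.trace = 1}

/-- The partial trace `tr_j` over qubit `j`. Here `j.insertNth k a` is the bit string with bit `k`
in position `j` and the bits of `a`, in order, in the other positions. -/
def ptrace {n : ℕ} (j : Fin (n + 1)) (ρ : Matrix (Bits (n + 1)) (Bits (n + 1)) ℂ) :
    Matrix (Bits n) (Bits n) ℂ :=
  Matrix.of fun a b =>
    ∑ k : Fin 2, ρ (j.insertNth (α := fun _ => Fin 2) k a) (j.insertNth (α := fun _ => Fin 2) k b)

theorem posSemidef_ptrace {n : ℕ} (j : Fin (n + 1))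
    {ρ : Matrix (Bits (n + 1)) (Bits (n + 1)) ℂ} (h : ρ.PosSemidef) :
    (ptrace j ρ).PosSemidef := by
  have e : ptrace j ρ = ∑ k : Fin 2,
      ρ.submatrix (fun a : Bits n => j.insertNth (α := fun _ => Fin 2) k a)
        (fun a : Bits n => j.insertNth (α := fun _ => Fin 2) k a) := by
    ext a b
    simp [ptrace, Matrix.sum_apply]
  rw [e]
  exact Matrix.posSemidef_sum _ fun k _ => h.submatrix _

theorem trace_ptrace {n : ℕ} (j : Fin (n + 1))
    (ρ : Matrix (Bits (n + 1)) (Bits (n + 1)) ℂ) : (ptrace j ρ).trace = ρ.trace := by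
  simp only [Matrix.trace, Matrix.diag_apply, ptrace, Matrix.of_apply]
  rw [← (Fin.insertNthEquiv (fun _ => Fin 2) j).sum_comp (fun I => ρ I I),
    Fintype.sum_prod_type, Finset.sum_comm]
  rfl

/-- The map `D_{n+1} → D_n^{n+1}`, `ρ ↦ (tr_1 ρ, …, tr_{n+1} ρ)`, that sends a state of `n + 1`
qubits to the tuple of its `n`-qubit reduced density matrices. -/
def PTr {n : ℕ} (ρ : DensityMatrix (n + 1)) : Fin (n + 1) → DensityMatrix n :=
  fun j => ⟨ptrace j ρ.1, posSemidef_ptrace j ρ.2.1, (trace_ptrace j ρ.1).trans ρ.2.2⟩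

/-- `ρ` is undetermined by its reduced density matrices: more than one state, pure or mixed, has
the same reduced density matrices as `ρ`. -/
def Undetermined {n : ℕ} (ρ : DensityMatrix (n + 1)) : Prop :=
  (PTr ⁻¹' {PTr ρ}).Nontrivial

/-- The density matrix `|ψ⟩⟨ψ|` of a pure state `|ψ⟩`. -/
def PureState.toDensityMatrix {n : ℕ} (ψ : PureState n) : DensityMatrix n :=
  ⟨Matrix.vecMulVec ψ.1.ofLp (star ψ.1.ofLp), Matrix.posSemidef_vecMulVec_self_star _, by
    rw [Matrix.trace_vecMulVec, ← EuclideanSpace.inner_eq_star_dotProduct,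
      inner_self_eq_norm_sq_to_K, ψ.2]
    simp⟩

/-- The matrix of `U_1 ⊗ ⋯ ⊗ U_n` in the computational basis. -/
def localUnitary {n : ℕ} (U : Fin n → Matrix.unitaryGroup (Fin 2) ℂ) :
    Matrix (Bits n) (Bits n) ℂ :=
  Matrix.of fun I J => ∏ j, (U j : Matrix (Fin 2) (Fin 2) ℂ) (I j) (J j)

/-- `|ψ⟩` and `|φ⟩` are local-unitary equivalent: `|ψ⟩ = (U_1 ⊗ ⋯ ⊗ U_n)|φ⟩` for some unitary
`2 × 2` matrices `U_1, …, U_n`. -/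
def LUEquivalent {n : ℕ} (ψ φ : PureState n) : Prop :=
  ∃ U : Fin n → Matrix.unitaryGroup (Fin 2) ℂ, ψ.1.ofLp = localUnitary U *ᵥ φ.1.ofLp

/-- `|φ⟩ = α|0…0⟩ + β|1…1⟩` for some `α, β` with `αβ ≠ 0`. -/
def IsGeneralizedGHZ {n : ℕ} (φ : PureState n) : Prop :=
  ∃ α β : ℂ, α * β ≠ 0 ∧
    φ.1 = α • EuclideanSpace.single (fun _ => (0 : Fin 2)) (1 : ℂ) +
      β • EuclideanSpace.single (fun _ => (1 : Fin 2)) (1 : ℂ)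

end Qubits

end

/-!
Let `ψ` be a pure state of `N` qubits and let `ω = ∑ i, |χ_i⟩⟨χ_i|` be another state with the same
reduced density matrices.

Fix a qubit `j` and view `ψ` and the `χ_i` as pairs of slices along `j`. Equality of the partial
traces over `j` says that the Gram matrices of these slices agree. If the two slices of `ψ` are
linearly independent, the slices of all the `χ_i` together are therefore the image of those of `ψ`
under an isometry; in other words `χ_i = A_i ψ` for one-qubit matrices `A_i` acting on qubit `j`,
with `∑ i, A_i* A_i = 1` (`SlicesIndependent.exists_site_eq`). Both the `A_i` and this
normalization exist for every `j`, and the `A_i` are unique. If the slices are dependent, qubit `j`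
is unentangled, and for `N ≥ 2` this forces `ω = |ψ⟩⟨ψ|` (`slicesIndependent_of_ptrace_eq`).

For `N ≥ 3` the actions can be moved to different qubits, so the `A_i` at a fixed qubit commute
(`commute_of_site_eq`). A commuting family of `2 × 2` matrices with `∑ i, A_i* A_i = 1` is
diagonal in one orthonormal basis or consists of scalars
(`unitarilyDiagonalizable_of_commute` is the part of this that is needed). As `ω ≠ |ψ⟩⟨ψ|`, some
`χ = χ_i` is not a multiple of `ψ`; it is obtained from `ψ` by a unitarily diagonalizable, nonscalar
action on any one of the qubits. In the product of the eigenbases, the eigenvalue attached to a bit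
string `I` in the support of `ψ` can be read off from any one bit of `I`, so the support consists of
two complementary bit strings: `ψ` is a generalized GHZ state up to a local unitary
(`exists_isGeneralizedGHZ_of_site`). For `N = 1` and `N = 2`, Hermitian matrices with this property
are written down directly.

Conversely, the states `α|0…0⟩ + β|1…1⟩` and `α|0…0⟩ - β|1…1⟩` differ only in the coherence between
`|0…0⟩` and `|1…1⟩`, which vanishes under every partial trace (`undetermined_of_lUEquivalent`).
-/

namespace Qubits

/-! ### Tensor products of one-qubit matrices -/

section Tensor

variable {n : ℕ}

/-- The matrix of `A_1 ⊗ ⋯ ⊗ A_n` in the computational basis, for arbitrary one-qubit matrices. -/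
def tens (A : Fin n → Matrix (Fin 2) (Fin 2) ℂ) : Matrix (Bits n) (Bits n) ℂ :=
  Matrix.of fun I J => ∏ j, A j (I j) (J j)

theorem tens_apply (A : Fin n → Matrix (Fin 2) (Fin 2) ℂ) (I J : Bits n) :
    tens A I J = ∏ j, A j (I j) (J j) := rfl

theorem localUnitary_eq_tens (U : Fin n → Matrix.unitaryGroup (Fin 2) ℂ) :
    localUnitary U = tens fun j => (U j : Matrix (Fin 2) (Fin 2) ℂ) := rfl

theorem tens_mul (A B : Fin n → Matrix (Fin 2) (Fin 2) ℂ) : tens (A * B) = tens A * tens B := by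
  ext I J
  simp only [tens_apply, Matrix.mul_apply, Pi.mul_apply]
  rw [Finset.prod_univ_sum, Fintype.piFinset_univ]
  simp only [Finset.prod_mul_distrib]

theorem tens_one : tens (1 : Fin n → Matrix (Fin 2) (Fin 2) ℂ) = 1 := by
  ext I J
  rw [tens_apply, Matrix.one_apply]
  simp only [Pi.one_apply, Matrix.one_apply]
  rw [Finset.prod_ite_zero]
  simp [funext_iff]

theorem conjTranspose_tens (A : Fin n → Matrix (Fin 2) (Fin 2) ℂ) :
    (tens A)ᴴ = tens (star A) := by
  ext I J
  simp [tens_apply, Matrix.star_apply]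

theorem localUnitary_mul_conjTranspose (U : Fin n → Matrix.unitaryGroup (Fin 2) ℂ) :
    localUnitary U * (localUnitary U)ᴴ = 1 := by
  rw [localUnitary_eq_tens, conjTranspose_tens, ← tens_mul, ← tens_one]
  congr 1
  ext1 j
  exact Matrix.mem_unitaryGroup_iff.1 (U j).2

theorem conjTranspose_mul_localUnitary (U : Fin n → Matrix.unitaryGroup (Fin 2) ℂ) :
    (localUnitary U)ᴴ * localUnitary U = 1 :=
  mul_eq_one_comm.1 (localUnitary_mul_conjTranspose U)

/-- The one-qubit matrix `A` acting on qubit `j`, and the identity on the others. -/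
def site (j : Fin n) (A : Matrix (Fin 2) (Fin 2) ℂ) : Matrix (Bits n) (Bits n) ℂ :=
  tens (Pi.mulSingle j A)

theorem site_mulVec_insertNth (j : Fin (n + 1)) (A : Matrix (Fin 2) (Fin 2) ℂ)
    (ψ : Bits (n + 1) → ℂ) (k : Fin 2) (a : Bits n) :
    (site j A *ᵥ ψ) (j.insertNth (α := fun _ => Fin 2) k a) =
      ∑ l, A k l * ψ (j.insertNth (α := fun _ => Fin 2) l a) := by
  rw [Matrix.mulVec, dotProduct, ← (Fin.insertNthEquiv (fun _ => Fin 2) j).sum_comp,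
    Fintype.sum_prod_type]
  refine Finset.sum_congr rfl fun l _ => ?_
  rw [Finset.sum_eq_single a]
  · simp [site, tens_apply, Fin.prod_univ_succAbove _ j, Pi.mulSingle_eq_of_ne, Fin.insertNthEquiv]
  · intro b _ hb
    obtain ⟨m, hm⟩ := Function.ne_iff.1 hb
    have : (1 : Matrix (Fin 2) (Fin 2) ℂ) (a m) (b m) = 0 := Matrix.one_apply_ne hm.symm
    have h0 : ∏ m, (1 : Matrix (Fin 2) (Fin 2) ℂ) (a m) (b m) = 0 :=
      Finset.prod_eq_zero (Finset.mem_univ m) this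
    simp [site, tens_apply, Fin.prod_univ_succAbove _ j, Pi.mulSingle_eq_of_ne, h0]
  · simp

theorem site_mulVec_apply (j : Fin (n + 1)) (A : Matrix (Fin 2) (Fin 2) ℂ)
    (ψ : Bits (n + 1) → ℂ) (I : Bits (n + 1)) :
    (site j A *ᵥ ψ) I = ∑ l, A (I j) l * ψ (Function.update I j l) := by
  conv_lhs => rw [← Fin.insertNth_self_removeNth j I]
  rw [site_mulVec_insertNth]
  simp [Fin.insertNth_removeNth]

theorem site_diagonal_mulVec (j : Fin (n + 1)) (d : Fin 2 → ℂ) (ψ : Bits (n + 1) → ℂ)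
    (I : Bits (n + 1)) : (site j (Matrix.diagonal d) *ᵥ ψ) I = d (I j) * ψ I := by
  rw [site_mulVec_apply, Finset.sum_eq_single (I j)]
  · simp
  · intro l _ hl
    rw [Matrix.diagonal_apply_ne _ hl.symm, zero_mul]
  · simp

theorem site_smul_one_mulVec (j : Fin (n + 1)) (c : ℂ) (ψ : Bits (n + 1) → ℂ) :
    site j (c • (1 : Matrix (Fin 2) (Fin 2) ℂ)) *ᵥ ψ = c • ψ := by
  ext I
  rw [Matrix.smul_one_eq_diagonal, site_diagonal_mulVec]
  rfl

theorem site_mul (j : Fin n) (A B : Matrix (Fin 2) (Fin 2) ℂ) :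
    site j (A * B) = site j A * site j B := by
  rw [site, Pi.mulSingle_mul, tens_mul]
  rfl

theorem site_mul_site_comm {j k : Fin n} (h : j ≠ k) (A B : Matrix (Fin 2) (Fin 2) ℂ) :
    site j A * site k B = site k B * site j A := by
  rw [site, site, ← tens_mul, ← tens_mul]
  congr 1
  exact Pi.mulSingle_commute (f := fun _ => Matrix (Fin 2) (Fin 2) ℂ) h A B

/-- A local unitary carries the action of `A` on qubit `j` to that of `U_j A U_j*`. -/
theorem conjTranspose_localUnitary_mul_site (U : Fin n → Matrix.unitaryGroup (Fin 2) ℂ) (j : Fin n)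
    (A : Matrix (Fin 2) (Fin 2) ℂ) :
    (localUnitary U)ᴴ * site j ((U j : Matrix (Fin 2) (Fin 2) ℂ) * A *
      star (U j : Matrix (Fin 2) (Fin 2) ℂ)) = site j A * (localUnitary U)ᴴ := by
  rw [localUnitary_eq_tens, conjTranspose_tens, site, site, ← tens_mul, ← tens_mul]
  congr 1
  ext1 m
  rcases eq_or_ne m j with rfl | h
  · have := Matrix.mem_unitaryGroup_iff'.1 (U m).2
    simp only [Pi.mul_apply, Pi.star_apply, Pi.mulSingle_eq_same]
    rw [← mul_assoc, ← mul_assoc, this, one_mul]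
  · simp [Pi.mulSingle_eq_of_ne h]

end Tensor

/-! ### Unitary diagonalization of `2 × 2` matrices -/

section Diagonalization

/-- `A` is diagonal in some orthonormal basis. -/
def UnitarilyDiagonalizable (A : Matrix (Fin 2) (Fin 2) ℂ) : Prop :=
  ∃ (U : Matrix.unitaryGroup (Fin 2) ℂ) (d : Fin 2 → ℂ),
    A = (U : Matrix (Fin 2) (Fin 2) ℂ) * Matrix.diagonal d * star (U : Matrix (Fin 2) (Fin 2) ℂ)

theorem _root_.Matrix.IsHermitian.unitarilyDiagonalizable {A : Matrix (Fin 2) (Fin 2) ℂ}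
    (hA : A.IsHermitian) : UnitarilyDiagonalizable A :=
  ⟨hA.eigenvectorUnitary, _, by
    conv_lhs => rw [hA.spectral_theorem, Unitary.conjStarAlgAut_apply]⟩

/-- The columns of `U` are a unit eigenvector of `A` and a unit vector orthogonal to it. -/
theorem exists_unitary_upperTriangular (A : Matrix (Fin 2) (Fin 2) ℂ) :
    ∃ U : Matrix.unitaryGroup (Fin 2) ℂ,
      (star (U : Matrix (Fin 2) (Fin 2) ℂ) * A * (U : Matrix (Fin 2) (Fin 2) ℂ)) 1 0 = 0 := by
  obtain ⟨μ, hμ⟩ := Module.End.exists_eigenvalue (Matrix.toLin' A)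
  obtain ⟨v, hv⟩ := hμ.exists_hasEigenvector
  have hAv : A *ᵥ v = μ • v := by simpa using hv.apply_eq_smul
  have hv0 : v ≠ 0 := hv.2
  -- the unit vector proportional to `v`
  set r : ℝ := Complex.normSq (v 0) + Complex.normSq (v 1) with hr
  have hrpos : 0 < r := by
    have h0 := Complex.normSq_nonneg (v 0)
    have h1 := Complex.normSq_nonneg (v 1)
    rcases (add_nonneg h0 h1).lt_or_eq with h | h
    · exact h
    · exfalso
      have v0 : v 0 = 0 := Complex.normSq_eq_zero.1 (by linarith)
      have v1 : v 1 = 0 := Complex.normSq_eq_zero.1 (by linarith)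
      apply hv0
      ext i
      fin_cases i
      exacts [v0, v1]
  set t : ℂ := Complex.ofReal (Real.sqrt r)⁻¹ with ht
  have htt : t * t * (v 0 * star (v 0) + v 1 * star (v 1)) = 1 := by
    have : v 0 * star (v 0) + v 1 * star (v 1) = (r : ℂ) := by
      simp [hr, ← Complex.mul_conj]
    rw [this, ht, ← Complex.ofReal_mul, ← Complex.ofReal_mul, ← mul_inv,
      Real.mul_self_sqrt hrpos.le, inv_mul_cancel₀ hrpos.ne', Complex.ofReal_one]
  have hts : star t = t := by simp [ht]
  have e0 : A 0 0 * v 0 + A 0 1 * v 1 = μ * v 0 := by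
    simpa [Matrix.mulVec, dotProduct, Fin.sum_univ_two] using congrFun hAv 0
  have e1 : A 1 0 * v 0 + A 1 1 * v 1 = μ * v 1 := by
    simpa [Matrix.mulVec, dotProduct, Fin.sum_univ_two] using congrFun hAv 1
  refine ⟨⟨!![t * v 0, -(t * star (v 1)); t * v 1, t * star (v 0)], ?_⟩, ?_⟩
  · rw [Matrix.mem_unitaryGroup_iff']
    ext i j
    fin_cases i <;> fin_cases j <;>
      simp [Matrix.mul_apply, Fin.sum_univ_two] <;>
      simp only [← Complex.star_def, hts]
    · linear_combination htt
    · ring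
    · ring
    · linear_combination htt
  · simp [Matrix.mul_apply, Fin.sum_univ_two]
    simp only [← Complex.star_def, hts]
    linear_combination -(t * t * v 1) * e0 + (t * t * v 0) * e1

/-- In an orthonormal basis that makes `A i₀` upper triangular, a nonzero off-diagonal entry `c` of
`A i₀` would make every commuting `A i` upper triangular, with diagonal entries differing by a fixed
multiple of the off-diagonal entry `q i`; the normalization then gives `∑ i, ‖q i‖ ^ 2 = 0`, which
contradicts `q i₀ = c ≠ 0`. -/
theorem unitarilyDiagonalizable_of_commute {ι : Type*} [Fintype ι]
    (A : ι → Matrix (Fin 2) (Fin 2) ℂ) (hA : ∑ i, (A i)ᴴ * A i = 1) (i₀ : ι)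
    (hc : ∀ i, A i₀ * A i = A i * A i₀) : UnitarilyDiagonalizable (A i₀) := by
  obtain ⟨U, hU⟩ := exists_unitary_upperTriangular (A i₀)
  have hU1 := Matrix.mem_unitaryGroup_iff'.1 U.2
  have hU2 := Matrix.mem_unitaryGroup_iff.1 U.2
  set V : Matrix (Fin 2) (Fin 2) ℂ := U.1 with hV
  set B : ι → Matrix (Fin 2) (Fin 2) ℂ := fun i => star V * A i * V with hB
  have hBA : ∀ i j, B i * B j = star V * (A i * A j) * V := fun i j => by
    calc B i * B j = star V * A i * (V * star V) * A j * V := by simp only [hB, mul_assoc]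
      _ = _ := by rw [hU2]; simp only [mul_assoc, one_mul]
  have hBc : ∀ i, B i₀ * B i = B i * B i₀ := fun i => by rw [hBA, hBA, hc]
  have hBs : ∑ i, (B i)ᴴ * B i = 1 := by
    have : ∀ i, (B i)ᴴ * B i = star V * ((A i)ᴴ * A i) * V := fun i => by
      calc (B i)ᴴ * B i = star V * (A i)ᴴ * (V * star V) * A i * V := by
            simp only [hB, ← Matrix.star_eq_conjTranspose, star_mul, star_star,
              mul_assoc]
        _ = _ := by rw [hU2]; simp only [mul_assoc, one_mul]
    simp only [this]
    rw [← Finset.sum_mul, ← Finset.mul_sum, hA, mul_one, hU1]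
  have hr0 : B i₀ 1 0 = 0 := hU
  suffices hq0 : B i₀ 0 1 = 0 by
    refine ⟨U, fun k => B i₀ k k, ?_⟩
    have hd : Matrix.diagonal (fun k => B i₀ k k) = B i₀ := by
      ext k l
      fin_cases k <;> fin_cases l <;> simp [hr0, hq0]
    calc A i₀ = (V * star V) * A i₀ * (V * star V) := by rw [hU2, one_mul, mul_one]
      _ = V * B i₀ * star V := by simp only [hB, mul_assoc]
      _ = _ := by rw [hd]
  by_contra hne
  set c := B i₀ 0 1 with hcdef
  have hr : ∀ i, B i 1 0 = 0 := fun i => by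
    have := congrFun (congrFun (hBc i) 0) 0
    simp only [Matrix.mul_apply, Fin.sum_univ_two, hr0] at this
    have h2 : c * B i 1 0 = 0 := by linear_combination this
    exact (mul_eq_zero.1 h2).resolve_left hne
  set y := (B i₀ 0 0 - B i₀ 1 1) / c with hy
  have hyc : y * c = B i₀ 0 0 - B i₀ 1 1 := div_mul_cancel₀ _ hne
  have hs : ∀ i, B i 1 1 = B i 0 0 - B i 0 1 * y := fun i => by
    have := congrFun (congrFun (hBc i) 0) 1
    simp only [Matrix.mul_apply, Fin.sum_univ_two] at this
    apply mul_left_cancel₀ hne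
    linear_combination this + B i 0 1 * hyc
  have h00 := congrFun (congrFun hBs 0) 0
  have h01 := congrFun (congrFun hBs 0) 1
  have h11 := congrFun (congrFun hBs 1) 1
  simp only [Matrix.sum_apply, Matrix.mul_apply, Fin.sum_univ_two, Matrix.conjTranspose_apply, hr,
    star_zero, zero_mul, add_zero, Matrix.one_apply_eq] at h00 h11
  simp only [Matrix.sum_apply, Matrix.mul_apply, Fin.sum_univ_two, Matrix.conjTranspose_apply, hr,
    star_zero, zero_mul, add_zero, Matrix.one_apply_ne zero_ne_one] at h01
  have h10 : ∑ i, star (B i 0 1) * B i 0 0 = 0 := by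
    have := congrArg star h01
    simpa [star_sum, mul_comm] using this
  have key : (∑ i, star (B i 0 1) * B i 0 1) * (1 + star y * y) = 0 := by
    have e : ∀ i, star (B i 0 1) * B i 0 1 + star (B i 1 1) * B i 1 1 =
        star (B i 0 1) * B i 0 1 * (1 + star y * y) + star (B i 0 0) * B i 0 0 -
          star (B i 0 0) * B i 0 1 * y - star (B i 0 1) * B i 0 0 * star y := fun i => by
      rw [hs, star_sub, star_mul']
      ring
    simp only [e, Finset.sum_add_distrib, Finset.sum_sub_distrib, ← Finset.sum_mul] at h11
    rw [h00, h01, h10] at h11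
    linear_combination h11
  -- `key` is the `(1, 1)` entry of the normalization, simplified by its other entries
  have hpos : (0 : ℂ) < 1 + star y * y := add_pos_of_pos_of_nonneg one_pos (star_mul_self_nonneg y)
  have hsum := (mul_eq_zero.1 key).resolve_right hpos.ne'
  rw [Finset.sum_eq_zero_iff_of_nonneg fun i _ => star_mul_self_nonneg _] at hsum
  exact hne (by simpa using hsum i₀ (Finset.mem_univ _))

end Diagonalization

/-! ### From local diagonal actions to GHZ states -/

section Diagonal

variable {n : ℕ}

theorem star_dotProduct_localUnitary_mulVec (U : Fin n → Matrix.unitaryGroup (Fin 2) ℂ)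
    (x : Bits n → ℂ) :
    star (localUnitary U *ᵥ x) ⬝ᵥ (localUnitary U *ᵥ x) = star x ⬝ᵥ x := by
  rw [Matrix.star_mulVec, ← Matrix.dotProduct_mulVec, Matrix.mulVec_mulVec,
    conjTranspose_mul_localUnitary, Matrix.one_mulVec]

theorem norm_eq_one_iff_star_dotProduct (x : EuclideanSpace ℂ (Bits n)) :
    ‖x‖ = 1 ↔ star x.ofLp ⬝ᵥ x.ofLp = 1 := by
  rw [dotProduct_comm, ← EuclideanSpace.inner_eq_star_dotProduct, inner_self_eq_norm_sq_to_K]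
  constructor
  · intro h
    simp [h]
  · intro h
    have h2 : ((‖x‖ ^ 2 : ℝ) : ℂ) = 1 := by simpa using h
    exact (pow_eq_one_iff_of_nonneg (norm_nonneg x) two_ne_zero).1 (by exact_mod_cast h2)

/-- Permuting the columns of the factors `U_m` turns the images of `|I⟩` and `|J⟩`, for
complementary bit strings `I` and `J`, into those of `|0…0⟩` and `|1…1⟩`. -/
theorem exists_localUnitary_mulVec_single (U : Fin n → Matrix.unitaryGroup (Fin 2) ℂ)
    (I J : Bits n) (hIJ : ∀ m, I m ≠ J m) :
    ∃ V : Fin n → Matrix.unitaryGroup (Fin 2) ℂ,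
      localUnitary V *ᵥ Pi.single (fun _ => 0) 1 = localUnitary U *ᵥ Pi.single I 1 ∧
      localUnitary V *ᵥ Pi.single (fun _ => 1) 1 = localUnitary U *ᵥ Pi.single J 1 := by
  have hσ : ∀ m, ∃ σ : Fin 2 ≃ Fin 2, σ 0 = I m ∧ σ 1 = J m := by
    intro m
    have := hIJ m
    generalize I m = x, J m = y at this
    revert x y
    decide
  choose σ hσ0 hσ1 using hσ
  refine ⟨fun m => ⟨(U m : Matrix (Fin 2) (Fin 2) ℂ).submatrix id (σ m), ?_⟩, ?_, ?_⟩
  · rw [Matrix.mem_unitaryGroup_iff', Matrix.star_eq_conjTranspose, Matrix.conjTranspose_submatrix,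
      ← Matrix.submatrix_mul _ _ _ _ _ Function.bijective_id, ← Matrix.star_eq_conjTranspose,
      Matrix.mem_unitaryGroup_iff'.1 (U m).2, Matrix.submatrix_one_equiv]
  · ext x
    simp [localUnitary, hσ0]
  · ext x
    simp [localUnitary, hσ1]

/-- If one vector `χ` outside the line of `ψ` is obtained from `ψ` by acting on any single qubit
with a unitarily diagonalizable matrix, then `ψ` is a generalized GHZ state up to a local
unitary. In the product of the eigenbases, the action on qubit `j` multiplies the coordinate of
`ψ` at `I` by an eigenvalue that depends only on `I j`; as this eigenvalue is the same for all `j`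
and separates the two values of each bit, only two complementary bit strings are in the support. -/
theorem exists_isGeneralizedGHZ_of_site (ψ : PureState (n + 1)) (χ : Bits (n + 1) → ℂ)
    (hχ : ∀ c : ℂ, χ ≠ c • ψ.1.ofLp)
    (h : ∀ j, ∃ A, UnitarilyDiagonalizable A ∧ site j A *ᵥ ψ.1.ofLp = χ) :
    ∃ φ : PureState (n + 1), IsGeneralizedGHZ φ ∧ LUEquivalent ψ φ := by
  choose A hA hAψ using h
  choose U d hUd using hA
  set ψ' := (localUnitary U)ᴴ *ᵥ ψ.1.ofLp with hψ'
  set χ' := (localUnitary U)ᴴ *ᵥ χ with hχ'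
  have hψ : localUnitary U *ᵥ ψ' = ψ.1.ofLp := by
    rw [hψ', Matrix.mulVec_mulVec, localUnitary_mul_conjTranspose, Matrix.one_mulVec]
  have hχ'' : localUnitary U *ᵥ χ' = χ := by
    rw [hχ', Matrix.mulVec_mulVec, localUnitary_mul_conjTranspose, Matrix.one_mulVec]
  have hd : ∀ j I, χ' I = d j (I j) * ψ' I := fun j I => by
    rw [← site_diagonal_mulVec, hψ', Matrix.mulVec_mulVec, ← conjTranspose_localUnitary_mul_site,
      ← hUd, ← Matrix.mulVec_mulVec, hAψ]
  have hne : ∀ c : ℂ, χ' ≠ c • ψ' := fun c hc => hχ c (by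
    rw [← hχ'', hc, Matrix.mulVec_smul, hψ])
  -- equal eigenvalues at one qubit, or a support on which bit `0` is constant, would make `χ`
  -- a multiple of `ψ`
  have hinj : ∀ j, Function.Injective (d j) := by
    intro j
    have hj : d j 0 ≠ d j 1 := fun e => hne (d j 0) (by
      ext I
      rw [hd j I]
      have : ∀ k : Fin 2, d j k = d j 0 := by
        intro k
        fin_cases k
        exacts [rfl, e.symm]
      rw [this, Pi.smul_apply, smul_eq_mul])
    intro k l hkl
    fin_cases k <;> fin_cases l <;> simp_all
  have hsupp : ∀ k : Fin 2, ∃ I, I 0 = k ∧ ψ' I ≠ 0 := by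
    intro k
    by_contra hk
    push Not at hk
    refine hne (d 0 (1 - k)) ?_
    ext I
    rw [Pi.smul_apply, smul_eq_mul]
    by_cases hI : I 0 = k
    · rw [hd 0 I, hk I hI, mul_zero, mul_zero]
    · rw [hd 0 I]
      have : ∀ x k : Fin 2, x ≠ k → x = 1 - k := by decide
      rw [this _ _ hI]
  have hconst : ∀ K, ψ' K ≠ 0 → ∀ j, d j (K j) = d 0 (K 0) := fun K hK j =>
    mul_right_cancel₀ hK ((hd j K).symm.trans (hd 0 K))
  obtain ⟨I, hI0, hI⟩ := hsupp 0
  obtain ⟨J, hJ0, hJ⟩ := hsupp 1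
  have hIJ : ∀ m, I m ≠ J m := by
    intro m hm
    have h1 := hconst I hI m
    have h2 := hconst J hJ m
    rw [hm, h2] at h1
    have := hinj 0 h1
    rw [hI0, hJ0] at this
    exact one_ne_zero this
  have huniq : ∀ K L, ψ' K ≠ 0 → ψ' L ≠ 0 → K 0 = L 0 → K = L := by
    intro K L hK hL hKL
    ext1 j
    apply hinj j
    rw [hconst K hK, hconst L hL, hKL]
  have hne' : I ≠ J := fun e => hIJ 0 (congrFun e 0)
  have hdecomp : ψ' = ψ' I • Pi.single I (1 : ℂ) + ψ' J • Pi.single J (1 : ℂ) := by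
    ext K
    by_cases hKI : K = I
    · subst hKI
      simp [hne']
    by_cases hKJ : K = J
    · subst hKJ
      simp [hne'.symm]
    have : ψ' K = 0 := by
      by_contra hK
      rcases Fin.exists_fin_two.1 ⟨K 0, rfl⟩ with e | e
      · exact hKI (huniq K I hK hI (e.trans hI0.symm))
      · exact hKJ (huniq K J hK hJ (e.trans hJ0.symm))
    simp [this, hKI, hKJ]
  obtain ⟨V, hV0, hV1⟩ := exists_localUnitary_mulVec_single U I J hIJ
  set φ : EuclideanSpace ℂ (Bits (n + 1)) :=
    ψ' I • EuclideanSpace.single (fun _ => (0 : Fin 2)) (1 : ℂ) +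
      ψ' J • EuclideanSpace.single (fun _ => (1 : Fin 2)) (1 : ℂ) with hφ
  have hVφ : ψ.1.ofLp = localUnitary V *ᵥ φ.ofLp := by
    rw [← hψ, hdecomp]
    simp [hφ, Matrix.mulVec_add, Matrix.mulVec_smul, hV0, hV1]
  refine ⟨⟨φ, ?_⟩, ⟨ψ' I, ψ' J, mul_ne_zero hI hJ, rfl⟩, V, hVφ⟩
  rw [norm_eq_one_iff_star_dotProduct, ← star_dotProduct_localUnitary_mulVec V, ← hVφ,
    ← norm_eq_one_iff_star_dotProduct]
  exact ψ.2

end Diagonal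

/-! ### Slices along a qubit and partial traces -/

section Slices

variable {n : ℕ}

/-- The `2 × 2ⁿ` matrix whose rows are the two slices of `ψ` along qubit `j`. -/
def slice (j : Fin (n + 1)) (ψ : Bits (n + 1) → ℂ) : Matrix (Fin 2) (Bits n) ℂ :=
  Matrix.of fun k a => ψ (j.insertNth (α := fun _ => Fin 2) k a)

theorem slice_apply (j : Fin (n + 1)) (ψ : Bits (n + 1) → ℂ) (k : Fin 2) (a : Bits n) :
    slice j ψ k a = ψ (j.insertNth (α := fun _ => Fin 2) k a) := rfl

theorem slice_injective (j : Fin (n + 1)) : Function.Injective (slice (n := n) j) := by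
  intro ψ χ h
  ext I
  have := congrFun (congrFun h (I j)) (j.removeNth I)
  simpa [slice_apply] using this

theorem slice_site_self (j : Fin (n + 1)) (A : Matrix (Fin 2) (Fin 2) ℂ) (ψ : Bits (n + 1) → ℂ) :
    slice j (site j A *ᵥ ψ) = A * slice j ψ := by
  ext k a
  rw [slice_apply, site_mulVec_insertNth, Matrix.mul_apply]
  rfl

theorem slice_site_succAbove (k : Fin (n + 2)) (m : Fin (n + 1)) (A : Matrix (Fin 2) (Fin 2) ℂ)
    (ψ : Bits (n + 2) → ℂ) :
    slice k (site (k.succAbove m) A *ᵥ ψ) = slice k ψ * (site m A)ᵀ := by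
  ext l a
  rw [slice_apply, site_mulVec_apply]
  have : (slice k ψ * (site m A)ᵀ) l a = (site m A *ᵥ slice k ψ l) a := by
    simp [Matrix.mul_apply, Matrix.mulVec, dotProduct, mul_comm]
  rw [this, site_mulVec_apply]
  simp [slice_apply, Fin.insertNth_update]

/-- The two slices of `ψ` along qubit `j` are linearly independent; equivalently, qubit `j` is
entangled with the others. -/
def SlicesIndependent (j : Fin (n + 1)) (ψ : Bits (n + 1) → ℂ) : Prop :=
  ∀ c : Fin 2 → ℂ, c ᵥ* slice j ψ = 0 → c = 0

theorem SlicesIndependent.exists_rightInverse {j : Fin (n + 1)} {ψ : Bits (n + 1) → ℂ}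
    (h : SlicesIndependent j ψ) : ∃ R : Matrix (Bits n) (Fin 2) ℂ, slice j ψ * R = 1 := by
  have hdet : (slice j ψ * (slice j ψ)ᴴ).det ≠ 0 := by
    intro h0
    obtain ⟨c, hc, hc0⟩ := Matrix.exists_vecMul_eq_zero_iff.2 h0
    rw [Matrix.vecMul_self_mul_conjTranspose_eq_zero] at hc0
    exact hc (h c hc0)
  exact ⟨(slice j ψ)ᴴ * (slice j ψ * (slice j ψ)ᴴ)⁻¹, by
    rw [← Matrix.mul_assoc, Matrix.mul_nonsing_inv _ (isUnit_iff_ne_zero.2 hdet)]⟩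

theorem SlicesIndependent.site_injective {j : Fin (n + 1)} {ψ : Bits (n + 1) → ℂ}
    (h : SlicesIndependent j ψ) {A B : Matrix (Fin 2) (Fin 2) ℂ}
    (hAB : site j A *ᵥ ψ = site j B *ᵥ ψ) : A = B := by
  obtain ⟨R, hR⟩ := h.exists_rightInverse
  have := congrArg (fun χ => slice j χ * R) hAB
  simpa [slice_site_self, Matrix.mul_assoc, hR] using this

variable {ι : Type*} [Fintype ι]

/-- The slices along qubit `j` of a family of vectors `χ i`, stacked into one matrix. -/
def stackedSlice (j : Fin (n + 1)) (χ : ι → Bits (n + 1) → ℂ) : Matrix (ι × Fin 2) (Bits n) ℂ :=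
  Matrix.of fun p a => slice j (χ p.1) p.2 a

theorem ptrace_vecMulVec (j : Fin (n + 1)) (ψ : Bits (n + 1) → ℂ) :
    ptrace j (Matrix.vecMulVec ψ (star ψ)) = ((slice j ψ)ᴴ * slice j ψ)ᵀ := by
  ext a b
  simp [ptrace, Matrix.mul_apply, slice_apply, Matrix.vecMulVec_apply, mul_comm]

theorem ptrace_sum_vecMulVec (j : Fin (n + 1)) (χ : ι → Bits (n + 1) → ℂ) :
    ptrace j (∑ i, Matrix.vecMulVec (χ i) (star (χ i))) =
      ((stackedSlice j χ)ᴴ * stackedSlice j χ)ᵀ := by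
  ext a b
  simp only [ptrace, Matrix.of_apply, Matrix.sum_apply, Matrix.transpose_apply, Matrix.mul_apply,
    Fintype.sum_prod_type, Matrix.conjTranspose_apply, stackedSlice, slice_apply,
    Matrix.vecMulVec_apply, Pi.star_apply]
  rw [Finset.sum_comm]
  exact Finset.sum_congr rfl fun i _ => Finset.sum_congr rfl fun k _ => mul_comm _ _

theorem conjTranspose_stackedSlice_mul_self {j : Fin (n + 1)} {ψ : Bits (n + 1) → ℂ}
    {χ : ι → Bits (n + 1) → ℂ}
    (h : ptrace j (∑ i, Matrix.vecMulVec (χ i) (star (χ i))) =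
      ptrace j (Matrix.vecMulVec ψ (star ψ))) :
    (stackedSlice j χ)ᴴ * stackedSlice j χ = (slice j ψ)ᴴ * slice j ψ := by
  rw [ptrace_vecMulVec, ptrace_sum_vecMulVec] at h
  exact Matrix.transpose_injective h

/-- If `∑ i, |χ_i⟩⟨χ_i|` and `|ψ⟩⟨ψ|` have the same partial trace over qubit `j`, the stacked slices
of the `χ i` are the image of the slice matrix of `ψ` under an isometry; its blocks act on qubit `j`
and send `ψ` to the `χ i`. -/
theorem SlicesIndependent.exists_site_eq {j : Fin (n + 1)} {ψ : Bits (n + 1) → ℂ}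
    (hψ : SlicesIndependent j ψ) {χ : ι → Bits (n + 1) → ℂ}
    (h : ptrace j (∑ i, Matrix.vecMulVec (χ i) (star (χ i))) =
      ptrace j (Matrix.vecMulVec ψ (star ψ))) :
    ∃ A : ι → Matrix (Fin 2) (Fin 2) ℂ,
      (∀ i, site j (A i) *ᵥ ψ = χ i) ∧ ∑ i, (A i)ᴴ * A i = 1 := by
  obtain ⟨R, hR⟩ := hψ.exists_rightInverse
  have hTS := conjTranspose_stackedSlice_mul_self h
  set T := stackedSlice j χ with hT
  set S := slice j ψ with hS
  set V := T * R with hV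
  -- `1 - R * S` is annihilated by `S`, hence by `T`
  have hVS : V * S = T := by
    have h0 : Tᴴ * T * (1 - R * S) = 0 := by
      rw [hTS, Matrix.mul_sub, Matrix.mul_one, Matrix.mul_assoc, ← Matrix.mul_assoc S, hR,
        Matrix.one_mul, sub_self]
    rw [Matrix.conjTranspose_mul_self_mul_eq_zero, Matrix.mul_sub, Matrix.mul_one,
      sub_eq_zero] at h0
    rw [hV, Matrix.mul_assoc, ← h0]
  have hVV : Vᴴ * V = 1 := by
    calc Vᴴ * V = Rᴴ * (Tᴴ * T) * R := by
          rw [hV, Matrix.conjTranspose_mul]; simp only [Matrix.mul_assoc]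
      _ = (S * R)ᴴ * (S * R) := by
          rw [hTS, Matrix.conjTranspose_mul]; simp only [Matrix.mul_assoc]
      _ = 1 := by rw [hR]; simp
  refine ⟨fun i => Matrix.of fun k l => V (i, k) l, fun i => slice_injective j ?_, ?_⟩
  · rw [slice_site_self]
    ext k a
    have := congrFun (congrFun hVS (i, k)) a
    rw [Matrix.mul_apply] at this ⊢
    exact this
  · rw [← hVV]
    ext k l
    simp [Matrix.sum_apply, Matrix.mul_apply, Fintype.sum_prod_type]

/-- A one-qubit matrix on qubit `j` that annihilates `ψ` also annihilates the `χ i`, provided that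
`∑ i, |χ_i⟩⟨χ_i|` and `|ψ⟩⟨ψ|` have the same partial trace over some other qubit: on the slices along
that qubit the matrix acts by multiplication on the right. -/
theorem site_mulVec_eq_zero {j k : Fin (n + 1)} (hjk : j ≠ k) {ψ : Bits (n + 1) → ℂ}
    {χ : ι → Bits (n + 1) → ℂ}
    (h : ptrace k (∑ i, Matrix.vecMulVec (χ i) (star (χ i))) =
      ptrace k (Matrix.vecMulVec ψ (star ψ)))
    {C : Matrix (Fin 2) (Fin 2) ℂ} (hC : site j C *ᵥ ψ = 0) (i : ι) : site j C *ᵥ χ i = 0 := by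
  obtain ⟨m, rfl⟩ := Fin.exists_succAbove_eq hjk
  cases n with
  | zero => exact m.elim0
  | succ n =>
    have hTS := conjTranspose_stackedSlice_mul_self h
    have h0 : slice k ψ * (site m C)ᵀ = 0 := by
      rw [← slice_site_succAbove, hC]
      rfl
    have h1 : stackedSlice k χ * (site m C)ᵀ = 0 := by
      rw [← Matrix.conjTranspose_mul_self_mul_eq_zero, hTS, Matrix.mul_assoc, h0, Matrix.mul_zero]
    refine slice_injective k ?_
    rw [slice_site_succAbove]
    ext l a
    have := congrFun (congrFun h1 (i, l)) a
    rw [Matrix.mul_apply] at this ⊢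
    exact this

/-- Hermitian matrices with the same partial trace over qubit `j`, whose slices along qubit `j`
satisfy the same nontrivial linear relation, are equal: the relation leaves a single free block. -/
theorem eq_of_ptrace_eq_of_relation {j : Fin (n + 1)}
    {ω ρ : Matrix (Bits (n + 1)) (Bits (n + 1)) ℂ}
    (hω : ω.IsHermitian) (hρ : ρ.IsHermitian) (h : ptrace j ω = ptrace j ρ) {c : Fin 2 → ℂ}
    (hc : c ≠ 0)
    (hcω : ∀ a J, ∑ k, c k * ω (j.insertNth (α := fun _ => Fin 2) k a) J = 0)
    (hcρ : ∀ a J, ∑ k, c k * ρ (j.insertNth (α := fun _ => Fin 2) k a) J = 0) : ω = ρ := by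
  rw [← sub_eq_zero]
  set δ := ω - ρ with hδ
  have hδh : δ.IsHermitian := hω.sub hρ
  have hcδ : ∀ a J, c 0 * δ (j.insertNth (α := fun _ => Fin 2) 0 a) J +
      c 1 * δ (j.insertNth (α := fun _ => Fin 2) 1 a) J = 0 := fun a J => by
    have h1 := hcω a J
    have h2 := hcρ a J
    rw [Fin.sum_univ_two] at h1 h2
    simp only [hδ, Matrix.sub_apply]
    linear_combination h1 - h2
  have hcδ' : ∀ I b, star (c 0) * δ I (j.insertNth (α := fun _ => Fin 2) 0 b) +
      star (c 1) * δ I (j.insertNth (α := fun _ => Fin 2) 1 b) = 0 := fun I b => by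
    have := congrArg star (hcδ b I)
    simpa only [star_add, star_mul', hδh.apply, star_zero] using this
  have htr : ∀ a b,
      δ (j.insertNth (α := fun _ => Fin 2) 0 a) (j.insertNth (α := fun _ => Fin 2) 0 b) +
        δ (j.insertNth (α := fun _ => Fin 2) 1 a) (j.insertNth (α := fun _ => Fin 2) 1 b) = 0 :=
    fun a b => by
      have := congrFun (congrFun h a) b
      simp only [ptrace, Matrix.of_apply, Fin.sum_univ_two] at this
      simp only [hδ, Matrix.sub_apply]
      linear_combination this
  have hpos : star (c 0) * c 0 + star (c 1) * c 1 ≠ 0 := by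
    intro h0
    rw [add_eq_zero_iff_of_nonneg (star_mul_self_nonneg _) (star_mul_self_nonneg _)] at h0
    apply hc
    ext i
    fin_cases i
    · simpa using h0.1
    · simpa using h0.2
  have hall : ∀ a b k l, δ (j.insertNth (α := fun _ => Fin 2) k a)
      (j.insertNth (α := fun _ => Fin 2) l b) = 0 := by
    intro a b
    have r0 := hcδ a (j.insertNth (α := fun _ => Fin 2) 0 b)
    have r1 := hcδ a (j.insertNth (α := fun _ => Fin 2) 1 b)
    have s0 := hcδ' (j.insertNth (α := fun _ => Fin 2) 0 a) b
    have s1 := hcδ' (j.insertNth (α := fun _ => Fin 2) 1 a) b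
    have t := htr a b
    generalize ep : δ (j.insertNth (α := fun _ => Fin 2) 0 a) (j.insertNth (α := fun _ => Fin 2) 0 b) = p,
      eq : δ (j.insertNth (α := fun _ => Fin 2) 0 a) (j.insertNth (α := fun _ => Fin 2) 1 b) = q,
      er : δ (j.insertNth (α := fun _ => Fin 2) 1 a) (j.insertNth (α := fun _ => Fin 2) 0 b) = r,
      es : δ (j.insertNth (α := fun _ => Fin 2) 1 a) (j.insertNth (α := fun _ => Fin 2) 1 b) = s
      at r0 r1 s0 s1 t
    have hp : p = 0 := by
      apply (mul_eq_zero.1 (_ : (star (c 0) * c 0 + star (c 1) * c 1) * p = 0)).resolve_left hpos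
      linear_combination c 0 * s0 - star (c 1) * r1 + star (c 1) * c 1 * t
    have hs : s = 0 := by linear_combination t - hp
    subst hp hs
    have hq : q = 0 := by
      apply (mul_eq_zero.1 (_ : (star (c 0) * c 0 + star (c 1) * c 1) * q = 0)).resolve_left hpos
      linear_combination star (c 0) * r1 + c 1 * s0
    have hr : r = 0 := by
      apply (mul_eq_zero.1 (_ : (star (c 0) * c 0 + star (c 1) * c 1) * r = 0)).resolve_left hpos
      linear_combination c 0 * s1 + star (c 1) * r0
    intro k l
    fin_cases k <;> fin_cases l
    exacts [ep, eq.trans hq, er.trans hr, es]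
  ext I J
  rw [← Fin.insertNth_self_removeNth j I, ← Fin.insertNth_self_removeNth j J]
  exact hall _ _ _ _

end Slices

/-! ### States that share their reduced density matrices -/

section Reduced

variable {n : ℕ}

theorem site_mulVec_eq_zero_iff_vecMul_slice (j : Fin (n + 1)) (c : Fin 2 → ℂ)
    (ψ : Bits (n + 1) → ℂ) :
    site j (Matrix.of fun _ => c) *ᵥ ψ = 0 ↔ c ᵥ* slice j ψ = 0 := by
  rw [← (slice_injective j).eq_iff, slice_site_self]
  constructor
  · intro h
    exact congrFun h 0
  · intro h
    ext k a
    exact congrFun h a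

/-- With at least two qubits, a pure state in which some qubit is not entangled with the others is
determined by its reduced density matrices. -/
theorem slicesIndependent_of_ptrace_eq {ω : Matrix (Bits (n + 2)) (Bits (n + 2)) ℂ}
    (hω : ω.PosSemidef) {ψ : Bits (n + 2) → ℂ} (hne : ω ≠ Matrix.vecMulVec ψ (star ψ))
    (h : ∀ j, ptrace j ω = ptrace j (Matrix.vecMulVec ψ (star ψ))) (j : Fin (n + 2)) :
    SlicesIndependent j ψ := by
  intro c hcψ
  by_contra hc
  obtain ⟨m, χ, rfl⟩ := Matrix.posSemidef_iff_eq_sum_vecMulVec.1 hω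
  obtain ⟨k, hk⟩ := exists_ne j
  have hcχ : ∀ i, c ᵥ* slice j (χ i) = 0 := fun i => by
    rw [← site_mulVec_eq_zero_iff_vecMul_slice] at hcψ ⊢
    exact site_mulVec_eq_zero hk.symm (h k) hcψ i
  have hrel : ∀ (η : Bits (n + 2) → ℂ), c ᵥ* slice j η = 0 → ∀ a J,
      ∑ k, c k * Matrix.vecMulVec η (star η) (j.insertNth (α := fun _ => Fin 2) k a) J = 0 := by
    intro η hη a J
    have : ∑ k, c k * η (j.insertNth (α := fun _ => Fin 2) k a) = 0 := congrFun hη a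
    simp only [Matrix.vecMulVec_apply, ← mul_assoc]
    rw [← Finset.sum_mul, this, zero_mul]
  refine hne (eq_of_ptrace_eq_of_relation hω.isHermitian
    (Matrix.posSemidef_vecMulVec_self_star ψ).isHermitian (h j) hc (fun a J => ?_) (hrel ψ hcψ))
  simp only [Matrix.sum_apply, Finset.mul_sum]
  rw [Finset.sum_comm]
  exact Finset.sum_eq_zero fun i _ => hrel _ (hcχ i) a J

/-- A third qubit forces the one-qubit matrices that reach two given vectors to commute: each of
the two actions can be moved to a qubit of its own. -/
theorem commute_of_site_eq {ψ χ χ' : Bits (n + 3) → ℂ}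
    {A B : Fin (n + 3) → Matrix (Fin 2) (Fin 2) ℂ}
    (hψ : ∀ j, SlicesIndependent j ψ) (hA : ∀ j, site j (A j) *ᵥ ψ = χ)
    (hB : ∀ j, site j (B j) *ᵥ ψ = χ') (j : Fin (n + 3)) : A j * B j = B j * A j := by
  obtain ⟨k, hkj, l, hlj, hlk⟩ : ∃ k, k ≠ j ∧ ∃ l, l ≠ j ∧ l ≠ k := by
    obtain ⟨k, hk⟩ := exists_ne j
    obtain ⟨l, hl⟩ := Finset.exists_mem_notMem_of_card_lt_card
      (s := {j, k}) (t := (Finset.univ : Finset (Fin (n + 3))))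
      (Finset.card_le_two.trans_lt (by simp))
    exact ⟨k, hk, l, by simpa using hl⟩
  have hcomm : ∀ {p q : Fin (n + 3)} (_ : p ≠ q) (X Y : Matrix (Fin 2) (Fin 2) ℂ)
      (η : Bits (n + 3) → ℂ), site p X *ᵥ (site q Y *ᵥ η) = site q Y *ᵥ (site p X *ᵥ η) :=
    fun hpq X Y η => by
      rw [Matrix.mulVec_mulVec, site_mul_site_comm hpq, Matrix.mulVec_mulVec]
  apply (hψ j).site_injective
  rw [site_mul, site_mul, ← Matrix.mulVec_mulVec, ← Matrix.mulVec_mulVec]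
  calc site j (A j) *ᵥ (site j (B j) *ᵥ ψ)
      = site j (A j) *ᵥ (site l (B l) *ᵥ ψ) := by rw [hB, hB]
    _ = site l (B l) *ᵥ (site k (A k) *ᵥ ψ) := by rw [hcomm hlj.symm, hA, hA]
    _ = site k (A k) *ᵥ (site j (B j) *ᵥ ψ) := by rw [hcomm hlk, hB, hB]
    _ = site j (B j) *ᵥ (site j (A j) *ᵥ ψ) := by rw [hcomm hkj, hA, hA]

theorem exists_isGeneralizedGHZ_of_three_le {ω : Matrix (Bits (n + 3)) (Bits (n + 3)) ℂ}
    (hω : ω.PosSemidef) (ψ : PureState (n + 3))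
    (hne : ω ≠ Matrix.vecMulVec ψ.1.ofLp (star ψ.1.ofLp))
    (h : ∀ j, ptrace j ω = ptrace j (Matrix.vecMulVec ψ.1.ofLp (star ψ.1.ofLp))) :
    ∃ φ : PureState (n + 3), IsGeneralizedGHZ φ ∧ LUEquivalent ψ φ := by
  have hψ := slicesIndependent_of_ptrace_eq hω hne h
  obtain ⟨m, χ, rfl⟩ := Matrix.posSemidef_iff_eq_sum_vecMulVec.1 hω
  choose A hA hA1 using fun j => (hψ j).exists_site_eq (h j)
  -- if all the `χ i` were multiples of `ψ`, the two states would be equal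
  obtain ⟨i₀, hi₀⟩ : ∃ i, ∀ c : ℂ, χ i ≠ c • ψ.1.ofLp := by
    by_contra hall
    push Not at hall
    choose c hc using hall
    have hAc : ∀ i, A 0 i = c i • 1 := fun i =>
      (hψ 0).site_injective (by rw [hA, site_smul_one_mulVec, hc])
    have hc1 : ∑ i, c i * star (c i) = 1 := by
      have := congrFun (congrFun (hA1 0) 0) 0
      simpa [hAc, Matrix.sum_apply, mul_comm] using this
    refine hne ?_
    have : ∀ i, Matrix.vecMulVec (χ i) (star (χ i)) =
        (c i * star (c i)) • Matrix.vecMulVec ψ.1.ofLp (star ψ.1.ofLp) := fun i => by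
      rw [hc, star_smul, Matrix.smul_vecMulVec, Matrix.vecMulVec_smul, smul_smul]
    simp only [this]
    rw [← Finset.sum_smul, hc1, one_smul]
  exact exists_isGeneralizedGHZ_of_site ψ (χ i₀) hi₀ fun j => ⟨A j i₀,
    unitarilyDiagonalizable_of_commute (A j) (hA1 j) i₀ fun i =>
      commute_of_site_eq hψ (fun j => hA j i₀) (fun j => hA j i) j, hA j i₀⟩

/-- Any Hermitian `2 × 2` matrix commutes with a Hermitian matrix that is not scalar. -/
theorem exists_isHermitian_commute {G : Matrix (Fin 2) (Fin 2) ℂ} (hG : G.IsHermitian) :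
    ∃ A : Matrix (Fin 2) (Fin 2) ℂ, A.IsHermitian ∧ G * A = A * G ∧ ∀ c : ℂ, A ≠ c • 1 := by
  by_cases h : ∃ c : ℂ, G = c • 1
  · obtain ⟨c, rfl⟩ := h
    refine ⟨Matrix.diagonal ![0, 1], ?_, by simp, fun d hd => ?_⟩
    · rw [Matrix.isHermitian_diagonal_iff]
      intro i
      fin_cases i <;> simp [IsSelfAdjoint]
    · have h0 := congrFun (congrFun hd 0) 0
      have h1 := congrFun (congrFun hd 1) 1
      simp at h0 h1
      rw [← h0] at h1
      exact one_ne_zero h1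
  · push Not at h
    exact ⟨G, hG, rfl, h⟩

/-- An entangled state of two qubits is a generalized GHZ state up to a local unitary. For the
invertible matrix `Ψ` of its coordinates, a Hermitian `A` on the first qubit acts as the transpose
of `Ψ⁻¹ A Ψ` on the second; this is Hermitian when `A` commutes with `Ψ Ψ*`. -/
theorem exists_isGeneralizedGHZ_of_two (ψ : PureState 2) (hψ : SlicesIndependent 0 ψ.1.ofLp) :
    ∃ φ : PureState 2, IsGeneralizedGHZ φ ∧ LUEquivalent ψ φ := by
  set Ψ : Matrix (Fin 2) (Fin 2) ℂ := Matrix.of fun a b => ψ.1.ofLp ![a, b] with hΨ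
  have hIvec : ∀ I : Bits 2, I = ![I 0, I 1] := fun I => by
    ext i
    fin_cases i <;> rfl
  have hdet : IsUnit Ψ.det := by
    rw [isUnit_iff_ne_zero]
    intro h0
    obtain ⟨c, hc, hc0⟩ := Matrix.exists_vecMul_eq_zero_iff.2 h0
    refine hc (hψ c ?_)
    ext a
    have := congrFun hc0 (a 0)
    simp only [Matrix.vecMul, dotProduct, slice_apply, hΨ, Matrix.of_apply] at this ⊢
    refine Eq.trans (Finset.sum_congr rfl fun k _ => ?_) this
    rw [hIvec (Fin.insertNth _ _ _)]
    rfl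
  obtain ⟨A, hA, hAG, hAc⟩ :=
    exists_isHermitian_commute (Matrix.isHermitian_mul_conjTranspose_self Ψ)
  have hdetH : IsUnit Ψᴴ.det := by
    rw [Matrix.det_conjTranspose]
    exact hdet.star
  have hA' : (Ψ⁻¹ * A * Ψ).IsHermitian := by
    calc (Ψ⁻¹ * A * Ψ)ᴴ = Ψᴴ * A * (Ψᴴ)⁻¹ := by
          rw [Matrix.conjTranspose_mul, Matrix.conjTranspose_mul, hA.eq,
            Matrix.conjTranspose_nonsing_inv, mul_assoc]
      _ = Ψ⁻¹ * (Ψ * Ψᴴ * A) * (Ψᴴ)⁻¹ := by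
          simp only [mul_assoc]
          rw [Matrix.nonsing_inv_mul_cancel_left _ _ hdet]
      _ = Ψ⁻¹ * A * Ψ := by
          rw [hAG]
          simp only [mul_assoc]
          rw [Matrix.mul_nonsing_inv _ hdetH, mul_one]
  refine exists_isGeneralizedGHZ_of_site ψ (site 0 A *ᵥ ψ.1.ofLp) (fun c hc => hAc c ?_) fun j => ?_
  · apply hψ.site_injective
    rw [hc, site_smul_one_mulVec]
  · fin_cases j
    · exact ⟨A, hA.unitarilyDiagonalizable, rfl⟩
    · refine ⟨_, hA'.transpose.unitarilyDiagonalizable, ?_⟩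
      ext I
      have e0 : ∀ l, Function.update I 0 l = ![l, I 1] := fun l => by
        ext i
        fin_cases i <;> simp
      have e1 : ∀ l, Function.update I 1 l = ![I 0, l] := fun l => by
        ext i
        fin_cases i <;> simp
      have key : (Ψ * (Ψ⁻¹ * A * Ψ)) (I 0) (I 1) = (A * Ψ) (I 0) (I 1) := by
        rw [mul_assoc, Matrix.mul_nonsing_inv_cancel_left _ _ hdet]
      rw [Matrix.mul_apply, Matrix.mul_apply] at key
      simp only [hΨ, Matrix.of_apply] at key
      change (site 1 _ *ᵥ _) I = _
      rw [site_mulVec_apply, site_mulVec_apply]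
      simp only [e0, e1, Matrix.transpose_apply]
      rw [← key]
      exact Finset.sum_congr rfl fun l _ => mul_comm _ _

/-- Every state of a single qubit is a generalized GHZ state up to a unitary, because no nonzero
vector is a common eigenvector of the Pauli matrices `Z` and `X`. -/
theorem exists_isGeneralizedGHZ_of_one (ψ : PureState 1) :
    ∃ φ : PureState 1, IsGeneralizedGHZ φ ∧ LUEquivalent ψ φ := by
  suffices ∃ A : Matrix (Fin 2) (Fin 2) ℂ, A.IsHermitian ∧
      ∀ c : ℂ, site 0 A *ᵥ ψ.1.ofLp ≠ c • ψ.1.ofLp by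
    obtain ⟨A, hA, hAc⟩ := this
    refine exists_isGeneralizedGHZ_of_site ψ _ hAc fun j => ?_
    obtain rfl : j = 0 := Fin.fin_one_eq_zero j
    exact ⟨A, hA.unitarilyDiagonalizable, rfl⟩
  have hsite : ∀ (A : Matrix (Fin 2) (Fin 2) ℂ) (k : Fin 2), (site 0 A *ᵥ ψ.1.ofLp) (fun _ => k) =
      A k 0 * ψ.1.ofLp (fun _ => 0) + A k 1 * ψ.1.ofLp (fun _ => 1) := fun A k => by
    rw [site_mulVec_apply, Fin.sum_univ_two]
    have : ∀ l : Fin 2, Function.update (fun _ : Fin 1 => k) 0 l = fun _ => l := fun l => by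
      ext i
      rw [Subsingleton.elim i 0, Function.update_self]
    rw [this, this]
  by_contra hall
  push Not at hall
  obtain ⟨c, hc⟩ := hall !![1, 0; 0, -1] (by
    ext i j
    fin_cases i <;> fin_cases j <;> simp)
  obtain ⟨d, hd⟩ := hall !![0, 1; 1, 0] (by
    ext i j
    fin_cases i <;> fin_cases j <;> simp)
  have c0 := congrFun hc fun _ => 0
  have c1 := congrFun hc fun _ => 1
  have d0 := congrFun hd fun _ => 0
  have d1 := congrFun hd fun _ => 1
  rw [hsite] at c0 c1 d0 d1
  have hψ : ¬ (ψ.1.ofLp (fun _ => 0) = 0 ∧ ψ.1.ofLp (fun _ => 1) = 0) := by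
    rintro ⟨h0, h1⟩
    have : ψ.1 = 0 := by
      ext I
      have hI : I = fun _ => I 0 := by
        ext i
        rw [Subsingleton.elim i 0]
      rw [hI]
      rcases Fin.exists_fin_two.1 ⟨I 0, rfl⟩ with e | e <;> rw [e]
      exacts [h0, h1]
    have h2 := ψ.2
    rw [this, norm_zero] at h2
    exact zero_ne_one h2
  simp only [Pi.smul_apply, smul_eq_mul] at c0 c1 d0 d1
  generalize ψ.1.ofLp (fun _ => 0) = x, ψ.1.ofLp (fun _ => 1) = y at c0 c1 d0 d1 hψ
  simp at c0 c1 d0 d1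
  have hxy : x * y = 0 := by linear_combination (y * c0 - x * c1) / 2
  rcases mul_eq_zero.1 hxy with h | h
  · exact hψ ⟨h, by rw [d0, h, mul_zero]⟩
  · exact hψ ⟨by rw [d1, h, mul_zero], h⟩

/-! ### Generalized GHZ states are undetermined -/

theorem localUnitary_mulVec_single (U : Fin n → Matrix.unitaryGroup (Fin 2) ℂ) (J I : Bits n) :
    (localUnitary U *ᵥ Pi.single J 1) I = ∏ m, (U m : Matrix (Fin 2) (Fin 2) ℂ) (I m) (J m) := by
  rw [Matrix.mulVec_single_one]
  rfl

/-- The coherence between the images of `|0…0⟩` and `|1…1⟩` under a local unitary is invisible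
after tracing out any one qubit. -/
theorem ptrace_coherence (U : Fin (n + 1) → Matrix.unitaryGroup (Fin 2) ℂ) (j : Fin (n + 1)) :
    ptrace j (Matrix.vecMulVec (localUnitary U *ᵥ Pi.single (fun _ => 0) 1)
      (star (localUnitary U *ᵥ Pi.single (fun _ => 1) 1))) = 0 := by
  ext a b
  have := congrFun (congrFun (Matrix.mem_unitaryGroup_iff'.1 (U j).2) 1) 0
  rw [Matrix.mul_apply, Matrix.one_apply_ne one_ne_zero] at this
  simp only [ptrace, Matrix.of_apply, Matrix.vecMulVec_apply, Pi.star_apply,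
    localUnitary_mulVec_single, Fin.prod_univ_succAbove _ j, Fin.insertNth_apply_same,
    Fin.insertNth_apply_succAbove, Matrix.zero_apply, star_mul']
  simp only [Fin.sum_univ_two, Matrix.star_apply] at this ⊢
  linear_combination (∏ m, (U (j.succAbove m) : Matrix (Fin 2) (Fin 2) ℂ) (a m) 0) *
    star (∏ m, (U (j.succAbove m) : Matrix (Fin 2) (Fin 2) ℂ) (b m) 1) * this

/-- Flipping the sign of `β` in a generalized GHZ state gives a different pure state with the same
reduced density matrices. -/
theorem undetermined_of_lUEquivalent {ψ φ : PureState (n + 1)} (hφ : IsGeneralizedGHZ φ)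
    (h : LUEquivalent ψ φ) : Undetermined ψ.toDensityMatrix := by
  obtain ⟨α, β, hαβ, hφ⟩ := hφ
  obtain ⟨U, hU⟩ := h
  have h01 : (fun _ => 0 : Bits (n + 1)) ≠ fun _ => 1 := fun e => zero_ne_one (congrFun e 0)
  have hφ1 : φ.1.ofLp = α • Pi.single (fun _ => 0) 1 + β • Pi.single (fun _ => 1) 1 := by
    rw [hφ]
    simp
  set φ' : Bits (n + 1) → ℂ := α • Pi.single (fun _ => 0) 1 - β • Pi.single (fun _ => 1) 1 with hφ'
  have hnorm : ‖WithLp.toLp 2 (localUnitary U *ᵥ φ')‖ = 1 := by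
    have h1 := (norm_eq_one_iff_star_dotProduct φ.1).1 φ.2
    rw [norm_eq_one_iff_star_dotProduct, star_dotProduct_localUnitary_mulVec]
    rw [hφ1] at h1
    rw [hφ']
    simp [h01, h01.symm] at h1 ⊢
    exact h1
  have hptr : ∀ j,
      ptrace j (Matrix.vecMulVec (localUnitary U *ᵥ φ') (star (localUnitary U *ᵥ φ'))) =
      ptrace j (Matrix.vecMulVec ψ.1.ofLp (star ψ.1.ofLp)) := by
    intro j
    rw [hU, hφ1, hφ', Matrix.mulVec_sub, Matrix.mulVec_add]
    simp only [Matrix.mulVec_smul]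
    have hvw := ptrace_coherence U j
    generalize localUnitary U *ᵥ Pi.single (fun _ => 0) 1 = v,
      localUnitary U *ᵥ Pi.single (fun _ => 1) 1 = w at hvw
    ext a b
    have e1 := congrFun (congrFun hvw a) b
    have e2 := congrArg star (congrFun (congrFun hvw b) a)
    simp only [ptrace, Matrix.of_apply, Matrix.vecMulVec_apply, Pi.star_apply, Fin.sum_univ_two,
      Matrix.zero_apply, star_add, star_mul', star_star, star_zero] at e1 e2
    simp only [ptrace, Matrix.of_apply, Matrix.vecMulVec_apply, Pi.star_apply, Fin.sum_univ_two,
      Pi.add_apply, Pi.sub_apply, Pi.smul_apply, smul_eq_mul, star_add, star_sub, star_mul']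
    linear_combination -(2 * α * star β) * e1 - (2 * β * star α) * e2
  refine ⟨PureState.toDensityMatrix ⟨_, hnorm⟩, ?_, ψ.toDensityMatrix, rfl, fun e => ?_⟩
  · ext1 j
    exact Subtype.ext (hptr j)
  · have hback : ∀ x : Bits (n + 1) → ℂ, (localUnitary U)ᴴ *
        Matrix.vecMulVec (localUnitary U *ᵥ x) (star (localUnitary U *ᵥ x)) * localUnitary U =
          Matrix.vecMulVec x (star x) := fun x => by
      rw [Matrix.mul_vecMulVec, Matrix.mulVec_mulVec, conjTranspose_mul_localUnitary,
        Matrix.one_mulVec, Matrix.vecMulVec_mul, Matrix.star_mulVec, Matrix.vecMul_vecMul,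
        conjTranspose_mul_localUnitary, Matrix.vecMul_one]
    have e1 : Matrix.vecMulVec (localUnitary U *ᵥ φ') (star (localUnitary U *ᵥ φ')) =
        Matrix.vecMulVec ψ.1.ofLp (star ψ.1.ofLp) := congrArg Subtype.val e
    have e2 := hback φ'
    rw [e1, hU, hback, hφ1] at e2
    have e3 := congrFun (congrFun e2 fun _ => 0) fun _ => 1
    simp [hφ', Matrix.vecMulVec_apply, h01, h01.symm] at e3
    have : α * β = 0 := by simp_all [self_eq_neg]
    exact hαβ this

end Reduced

end Qubits


theorem mainTheorem1 (n : ℕ) (ψ : Qubits.PureState (n + 1)) :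
    Qubits.Undetermined ψ.toDensityMatrix ↔
      ∃ φ : Qubits.PureState (n + 1), Qubits.IsGeneralizedGHZ φ ∧ Qubits.LUEquivalent ψ φ := by
  refine ⟨fun h => ?_, fun ⟨φ, hφ, h⟩ => Qubits.undetermined_of_lUEquivalent hφ h⟩
  obtain ⟨ω, hω, hne⟩ := h.exists_ne ψ.toDensityMatrix
  have hne' : ω.1 ≠ Matrix.vecMulVec ψ.1.ofLp (star ψ.1.ofLp) := fun e => hne (Subtype.ext e)
  have hptr : ∀ j, Qubits.ptrace j ω.1 =
      Qubits.ptrace j (Matrix.vecMulVec ψ.1.ofLp (star ψ.1.ofLp)) :=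
    fun j => congrArg Subtype.val (congrFun hω j)
  match n with
  | 0 => exact Qubits.exists_isGeneralizedGHZ_of_one ψ
  | 1 =>
    exact Qubits.exists_isGeneralizedGHZ_of_two ψ
      (Qubits.slicesIndependent_of_ptrace_eq ω.2.1 hne' hptr 0)
  | n + 2 => exact Qubits.exists_isGeneralizedGHZ_of_three_le ω.2.1 ψ hne' hptr
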